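/- Let $d,N$ be natural numbers and let $\mathcal H=(\mathbb C^d)^{\otimes 2N}$ be the Hilbert space of a periodic spin chain with $2N$ sites, $\mathcal A=B(\mathcal H)$ its algebra of observables, and $\mathcal A_L\subset\mathcal A$ the algebra of operators acting on the first $N$ sites only, i.e. of the operators $y\otimes 1$ with $y\in B((\mathbb C^d)^{\otimes N})$. Let $U$ be the unitary operator on $\mathcal H$ with $$U(v_1\otimes v_2\otimes\dots\otimes v_{2N})=v_{2N-1}\otimes v_{2N}\otimes v_1\otimes\dots\otimes v_{2N-2},$$ which generates the $\mathbb Z/N$-rotations of the chain, and let $J$ be the anti-unitary operator on $\mathcal H$ with $$J(v_1\otimes v_2\otimes\dots\otimes v_{2N})=\bar v_{2N}\otimes\bar v_{2N-1}\otimes\dots\otimes\bar v_1,$$ where the bar is componentwise complex conjugation in $\mathbb C^d$. Let $\Omega\in\mathcal H$ be a unit vector and let $\rho=|\Omega\rangle\langle\Omega|$ be the density matrix of the pure state on $\mathcal A$ represented by $\Omega$. Suppose that this state is 1. invariant under $\mathbb Z/N$-rotations: $\operatorname{Tr}(\rho\,UaU^{-1})=\operatorname{Tr}(\rho\,a)$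 for all $a\in\mathcal A$; 2. reflection positive: $\operatorname{Tr}(\rho\,xJxJ)$ is real and $\ge 0$ for all $x\in\mathcal A_L$. Then the state has vanishing angular momentum: $U\Omega=\Omega$. -/

import Mathlib

open scoped ComplexOrder InnerProductSpace

noncomputable section

namespace SpinChain

/-- The Hilbert space `(ℂ^d)^{⊗ 2N}` of a spin chain with `2N` sites, in coordinates with respect to
the product basis: a vector is a complex function of the basis labels `σ : Fin (2 * N) → Fin d`,
and the inner product is the standard one. Site number `k = 1, …, 2N` is the index `k - 1`. -/
abbrev Hilb (d N : ℕ) : Type := EuclideanSpace ℂ (Fin (2 * N) → Fin d)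

/-- The Hilbert space `(ℂ^d)^{⊗ N}` of a half-chain with `N` sites. -/
abbrev HalfHilb (d N : ℕ) : Type := EuclideanSpace ℂ (Fin N → Fin d)

/-- The algebra of observables: all operators on the Hilbert space of the chain. -/
abbrev Obs (d N : ℕ) : Type := Module.End ℂ (Hilb d N)

/-- The product vector `v₁ ⊗ v₂ ⊗ ⋯ ⊗ v_{2N}`. -/
def productVec {d N : ℕ} (v : Fin (2 * N) → EuclideanSpace ℂ (Fin d)) : Hilb d N :=
  WithLp.toLp 2 fun σ => ∏ i, v i (σ i)

/-! ### The shift by two sites -/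

/-- The permutation `i ↦ i + 2` (cyclically) of the sites. -/
def shiftSites (N : ℕ) : Equiv.Perm (Fin (2 * N)) := finRotate (2 * N) * finRotate (2 * N)

theorem shiftSites_val (N : ℕ) (i : Fin (2 * N)) :
    (shiftSites N i : ℕ) = (i + 2) % (2 * N) := by
  obtain _ | N := N
  · exact i.elim0
  · change Fin (2 * N + 1 + 1) at i
    change ((finRotate (2 * N + 1 + 1) (finRotate (2 * N + 1 + 1) i) : Fin (2 * N + 1 + 1)) : ℕ)
      = (i + 2) % (2 * N + 1 + 1)
    rw [finRotate_apply, finRotate_apply, Fin.val_add, Fin.val_add]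
    simp [add_assoc]

/-- The unitary operator `U` with
`U (v₁ ⊗ ⋯ ⊗ v_{2N}) = v_{2N-1} ⊗ v_{2N} ⊗ v₁ ⊗ ⋯ ⊗ v_{2N-2}`, see `shiftTwo_productVec`. -/
def shiftTwo (d N : ℕ) : Hilb d N ≃ₗᵢ[ℂ] Hilb d N :=
  LinearIsometryEquiv.piLpCongrLeft 2 ℂ ℂ ((shiftSites N).arrowCongr (Equiv.refl (Fin d)))

theorem shiftTwo_apply {d N : ℕ} (ψ : Hilb d N) (σ : Fin (2 * N) → Fin d) :
    shiftTwo d N ψ σ = ψ fun i => σ (shiftSites N i) := by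
  rfl

theorem shiftTwo_productVec {d N : ℕ} (v : Fin (2 * N) → EuclideanSpace ℂ (Fin d)) :
    shiftTwo d N (productVec v) = productVec fun i => v ((shiftSites N).symm i) := by
  ext σ
  rw [shiftTwo_apply]
  exact Fintype.prod_equiv (shiftSites N) _ _ fun i => by simp

/-! ### The CRT reflection -/

/-- The anti-linear operator `J` with
`J (v₁ ⊗ v₂ ⊗ ⋯ ⊗ v_{2N}) = v̄_{2N} ⊗ ⋯ ⊗ v̄₂ ⊗ v̄₁`, see `crt_productVec`. -/
def crt (d N : ℕ) : Hilb d N →ₗ⋆[ℂ] Hilb d N where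
  toFun ψ := WithLp.toLp 2 fun σ => (starRingEnd ℂ) (ψ fun i => σ i.rev)
  map_add' ψ φ := by ext σ; simp
  map_smul' c ψ := by ext σ; simp

theorem crt_apply {d N : ℕ} (ψ : Hilb d N) (σ : Fin (2 * N) → Fin d) :
    crt d N ψ σ = (starRingEnd ℂ) (ψ fun i => σ i.rev) := rfl

theorem crt_productVec {d N : ℕ} (v : Fin (2 * N) → EuclideanSpace ℂ (Fin d)) :
    crt d N (productVec v) =
      productVec fun i => WithLp.toLp 2 fun k => (starRingEnd ℂ) (v i.rev k) := by
  ext σ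
  rw [crt_apply]
  simp only [productVec, map_prod]
  exact Fintype.prod_equiv Fin.revPerm _ _ fun i => by simp

theorem crt_crt {d N : ℕ} (ψ : Hilb d N) : crt d N (crt d N ψ) = ψ := by
  ext σ
  simp [crt_apply]

/-- `J` is anti-unitary. -/
theorem inner_crt_crt {d N : ℕ} (ψ φ : Hilb d N) :
    ⟪crt d N ψ, crt d N φ⟫_ℂ = ⟪φ, ψ⟫_ℂ := by
  simp only [PiLp.inner_apply, crt_apply]
  refine Fintype.sum_equiv (Fin.revPerm.arrowCongr (Equiv.refl (Fin d))) _ _ fun σ => ?_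
  simp [Equiv.arrowCongr, Function.comp_def, mul_comm]

/-- The (linear) operator `J x J`. -/
def crtConj {d N : ℕ} (x : Obs d N) : Obs d N := (crt d N).comp (x.comp (crt d N))

/-! ### Observables of the left half-chain -/

/-- The labels of the first `N` sites. -/
def leftHalf {d N : ℕ} (σ : Fin (2 * N) → Fin d) : Fin N → Fin d :=
  fun i => σ ⟨i, by have := i.isLt; omega⟩

/-- The labels of the last `N` sites. -/
def rightHalf {d N : ℕ} (σ : Fin (2 * N) → Fin d) : Fin N → Fin d :=
  fun i => σ ⟨N + i, by have := i.isLt; omega⟩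

/-- Replace the labels of the first `N` sites by `s`. -/
def replaceLeft {d N : ℕ} (s : Fin N → Fin d) (σ : Fin (2 * N) → Fin d) : Fin (2 * N) → Fin d :=
  fun i => if h : (i : ℕ) < N then s ⟨i, h⟩ else σ i

theorem leftHalf_replaceLeft {d N : ℕ} (s : Fin N → Fin d) (σ : Fin (2 * N) → Fin d) :
    leftHalf (replaceLeft s σ) = s := by
  funext i
  simp [leftHalf, replaceLeft]

theorem rightHalf_replaceLeft {d N : ℕ} (s : Fin N → Fin d) (σ : Fin (2 * N) → Fin d) :
    rightHalf (replaceLeft s σ) = rightHalf σ := by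
  funext i
  simp [rightHalf, replaceLeft]

theorem replaceLeft_replaceLeft {d N : ℕ} (s t : Fin N → Fin d) (σ : Fin (2 * N) → Fin d) :
    replaceLeft s (replaceLeft t σ) = replaceLeft s σ := by
  funext i
  by_cases h : (i : ℕ) < N <;> simp [replaceLeft, h]

theorem replaceLeft_leftHalf {d N : ℕ} (σ : Fin (2 * N) → Fin d) :
    replaceLeft (leftHalf σ) σ = σ := by
  funext i
  by_cases h : (i : ℕ) < N <;> simp [replaceLeft, leftHalf, h]

/-- The vector `u ⊗ w` of the chain, for vectors `u`, `w` of the left and right half-chains. -/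
def tensorHalves {d N : ℕ} (u w : HalfHilb d N) : Hilb d N :=
  WithLp.toLp 2 fun σ => u (leftHalf σ) * w (rightHalf σ)

/-- The operator `y ⊗ 1` for an operator `y` on the left half-chain: `y` acts on the labels of the
first `N` sites, the others being fixed; see `leftOp_tensorHalves`. -/
def extendLeft {d N : ℕ} (y : Module.End ℂ (HalfHilb d N)) : Obs d N where
  toFun ψ := WithLp.toLp 2 fun σ => y (WithLp.toLp 2 fun s => ψ (replaceLeft s σ)) (leftHalf σ)
  map_add' ψ φ := by
    ext σ
    exact congrArg (fun z : HalfHilb d N => z (leftHalf σ)) (map_add y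
      (WithLp.toLp 2 fun s => ψ (replaceLeft s σ)) (WithLp.toLp 2 fun s => φ (replaceLeft s σ)))
  map_smul' c ψ := by
    ext σ
    exact congrArg (fun z : HalfHilb d N => z (leftHalf σ)) (map_smul y c
      (WithLp.toLp 2 fun s => ψ (replaceLeft s σ)))

theorem extendLeft_apply {d N : ℕ} (y : Module.End ℂ (HalfHilb d N)) (ψ : Hilb d N)
    (σ : Fin (2 * N) → Fin d) :
    extendLeft y ψ σ = y (WithLp.toLp 2 fun s => ψ (replaceLeft s σ)) (leftHalf σ) := rfl

/-- The embedding `y ↦ y ⊗ 1` of the operators on the left half-chain into the observables. -/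
def leftOp (d N : ℕ) : Module.End ℂ (HalfHilb d N) →ₐ[ℂ] Obs d N :=
  AlgHom.ofLinearMap
    { toFun := extendLeft
      map_add' := fun _ _ => rfl
      map_smul' := fun _ _ => rfl }
    (by
      refine LinearMap.ext fun ψ => PiLp.ext fun σ => ?_
      change extendLeft 1 ψ σ = ψ σ
      simp [extendLeft_apply, replaceLeft_leftHalf])
    (fun y z => by
      refine LinearMap.ext fun ψ => PiLp.ext fun σ => ?_
      change extendLeft (y * z) ψ σ = extendLeft y (extendLeft z ψ) σ
      simp [extendLeft_apply, leftHalf_replaceLeft, replaceLeft_replaceLeft])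

theorem leftOp_tensorHalves {d N : ℕ} (y : Module.End ℂ (HalfHilb d N)) (u w : HalfHilb d N) :
    leftOp d N y (tensorHalves u w) = tensorHalves (y u) w := by
  ext σ
  change y (WithLp.toLp 2 fun s => tensorHalves u w (replaceLeft s σ)) (leftHalf σ) = _
  have h : (WithLp.toLp 2 fun s => tensorHalves u w (replaceLeft s σ) : HalfHilb d N)
      = w (rightHalf σ) • u := by
    ext s
    simp [tensorHalves, leftHalf_replaceLeft, rightHalf_replaceLeft, mul_comm]
  rw [h]
  simp [tensorHalves, mul_comm]

/-- The algebra of observables of the first `N` sites. -/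
def leftAlgebra (d N : ℕ) : Subalgebra ℂ (Obs d N) := (leftOp d N).range

/-! ### States -/

/-- The density matrix `|Ω⟩⟨Ω|` of the pure state represented by a unit vector `Ω`. -/
def pureState {d N : ℕ} (Ω : Hilb d N) : Obs d N :=
  (innerSL ℂ Ω).toLinearMap.smulRight Ω

theorem pureState_apply {d N : ℕ} (Ω ψ : Hilb d N) : pureState Ω ψ = ⟪Ω, ψ⟫_ℂ • Ω := rfl

theorem trace_pureState_mul {d N : ℕ} (Ω : Hilb d N) (a : Obs d N) :
    LinearMap.trace ℂ (Hilb d N) (pureState Ω * a) = ⟪Ω, a Ω⟫_ℂ := by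
  rw [LinearMap.trace_mul_comm]
  have : a * pureState Ω = (innerSL ℂ Ω).toLinearMap.smulRight (a Ω) := by
    ext1 ψ
    simp [pureState]
  rw [this, LinearMap.trace_smulRight]
  rfl

/-- The state `a ↦ Tr (ρ a)` is reflection positive: `Tr (ρ x J x J) ≥ 0` for every observable `x`
of the first `N` sites (the order on `ℂ`: the number is real and non-negative). -/
def IsReflectionPositive {d N : ℕ} (ρ : Obs d N) : Prop :=
  ∀ x ∈ leftAlgebra d N, 0 ≤ LinearMap.trace ℂ (Hilb d N) (ρ * (x * crtConj x))

/-- The state `a ↦ Tr (ρ a)` is invariant under the automorphism `a ↦ U a U⁻¹`, hence under the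
group `ℤ/N` of rotations of the periodic chain that it generates. -/
def IsRotationInvariant {d N : ℕ} (ρ : Obs d N) : Prop :=
  ∀ a : Obs d N,
    LinearMap.trace ℂ (Hilb d N) (ρ * (shiftTwo d N).toLinearEquiv.conj a) =
      LinearMap.trace ℂ (Hilb d N) (ρ * a)

end SpinChain

end

namespace SpinChain

open Matrix

/-! ### Iterated reflections of configurations -/

/-! Read as a matrix `M` from the right half-chain (in reflected order) to the left one, `Ω` is
positive semidefinite up to a phase: testing reflection positivity on `|u⟩⟨v|` makes all values of
the quadratic form of `M` share one phase. Hence a suitable `c ≠ 0` gives `c * Ω σ ≥ 0` at every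
palindrome `σ`, and `|M s t|² ≤ |M s s| |M t t|`. Rotation invariance gives `UΩ = zΩ` with `|z| =
1`.

It remains to find a palindrome with nonzero coefficient whose rotation by two sites is again a
palindrome; comparing the two coefficients then forces `z = 1`. As in chessboard estimates, the
configurations maximizing `|Ω σ|` are stable under rotation and, by the Cauchy–Schwarz bound, under
folding the left half onto the right. Repeated folding yields a maximizer invariant under all
reflections (`exists_palindrome`). -/

theorem mod_eq_ite {x n : ℕ} (h : x < 2 * n) : x % n = if x < n then x else x - n := by
  split_ifs with hx
  · exact Nat.mod_eq_of_lt hx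
  · rw [Nat.mod_eq_sub_mod (by omega), Nat.mod_eq_of_lt (by omega)]

/-- The labels `i`, `j` are identified by the group of reflections generated by the
cuts of a chain of `2 * N` sites. -/
def ReflRel (N i j : ℕ) : Prop := N % 2 = 1 ∨ i % 4 = j % 4 ∨ (i + j) % 4 = 3

/-- The first `L` labels of `f` agree with a configuration invariant under all reflections. -/
def ReflInvariantUpTo {α : Type*} (N L : ℕ) (f : ℕ → α) : Prop :=
  ∀ i j, i < L → j < L → ReflRel N i j → f i = f j

section Chessboard

variable {α : Type*} {N : ℕ} {Q : (ℕ → α) → Prop}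

theorem rotate_iterate (hcongr : ∀ f g, (∀ i < 2 * N, f i = g i) → Q f → Q g)
    (hrot : ∀ f, Q f → Q fun i => f ((i + 2) % (2 * N))) (k : ℕ) :
    ∀ f, Q f → Q fun i => f ((i + 2 * k) % (2 * N)) := by
  induction k with
  | zero =>
    intro f hf
    refine hcongr f _ (fun i hi => ?_) hf
    simp [Nat.mod_eq_of_lt hi]
  | succ k ih =>
    intro f hf
    refine hcongr _ _ (fun i _ => ?_) (hrot _ (ih f hf))
    simp only [Nat.mod_add_mod]
    congr 2
    ring

/-- Folding mirrors an invariant block across a cut and so doubles it. The reflections send `i` to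
`4 * k - 1 - i` modulo `2 * N`: for even `N` they preserve the classes of `ReflRel`, for odd `N`
they identify all sites. -/
theorem exists_reflInvariantUpTo_double
    (hcongr : ∀ f g, (∀ i < 2 * N, f i = g i) → Q f → Q g)
    (hrot : ∀ f, Q f → Q fun i => f ((i + 2) % (2 * N)))
    (hfold : ∀ f, Q f → Q fun i => if i < N then f i else f (2 * N - 1 - i))
    {L : ℕ} (hL : L ≤ N) (hpar : N % 2 = 0 → L % 2 = 0)
    (h : ∃ f, Q f ∧ ReflInvariantUpTo N L f) :
    ∃ f, Q f ∧ ReflInvariantUpTo N (2 * L) f := by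
  obtain ⟨f, hf, hgood⟩ := h
  have hshift := rotate_iterate hcongr hrot
  by_cases hLe : L % 2 = 0
  -- The block at `0, …, L - 1` is mirrored across the cut between `2 * N - 1` and `0`; since `L` is
  -- even, rotations by two sites bring the doubled block to the start.
  · refine ⟨_, hshift ((2 * N - L) / 2) _ (hfold _ hf), fun i j hi hj hij => ?_⟩
    have hk : 2 * ((2 * N - L) / 2) = 2 * N - L := by omega
    have key : ∀ i < 2 * L, (fun i => if i < N then f i else f (2 * N - 1 - i))
        ((i + 2 * ((2 * N - L) / 2)) % (2 * N)) = f (if i < L then L - 1 - i else i - L) := by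
      intro i hi
      rw [hk, mod_eq_ite (by omega)]
      dsimp only
      split_ifs <;> first | omega | (congr 1; omega)
    refine (key i hi).trans (Eq.trans ?_ (key j hj).symm)
    unfold ReflRel at hij
    refine hgood _ _ (by split_ifs <;> omega) (by split_ifs <;> omega) ?_
    unfold ReflRel
    split_ifs <;> omega
  -- For odd `L` the other cut has the right parity: the block is first moved to end at `N - 1`,
  -- then mirrored there and moved back by `N - L`.
  · have hN : N % 2 = 1 := by omega
    refine ⟨_, hshift ((N - L) / 2) _ (hfold _ (hshift ((N + L) / 2) _ hf)),
      fun i j hi hj _ => ?_⟩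
    have hk : 2 * ((N - L) / 2) = N - L := by omega
    have hk' : 2 * ((N + L) / 2) = N + L := by omega
    have key : ∀ i < 2 * L, (fun i => if i < N then (fun i => f ((i + 2 * ((N + L) / 2)) % (2 * N))) i
        else (fun i => f ((i + 2 * ((N + L) / 2)) % (2 * N))) (2 * N - 1 - i))
        ((i + 2 * ((N - L) / 2)) % (2 * N)) = f 0 := by
      intro i hi
      rw [hk, hk', mod_eq_ite (by omega)]
      dsimp only
      split_ifs <;> first
        | omega
        | (rw [mod_eq_ite (by omega)]
           split_ifs <;> first
             | omega
             | exact hgood _ _ (by omega) (by omega) (Or.inl hN))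
    exact (key i hi).trans (key j hj).symm

theorem exists_reflInvariantUpTo
    (hcongr : ∀ f g, (∀ i < 2 * N, f i = g i) → Q f → Q g)
    (hrot : ∀ f, Q f → Q fun i => f ((i + 2) % (2 * N)))
    (hfold : ∀ f, Q f → Q fun i => if i < N then f i else f (2 * N - 1 - i))
    (hQ : ∃ f, Q f) : ∃ f, Q f ∧ ReflInvariantUpTo N N f := by
  have hdouble := fun {L} => exists_reflInvariantUpTo_double (L := L) hcongr hrot hfold
  have mono : ∀ {L L'}, L' ≤ L → (∃ f, Q f ∧ ReflInvariantUpTo N L f) →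
      ∃ f, Q f ∧ ReflInvariantUpTo N L' f := fun hL ⟨f, hf, hg⟩ =>
    ⟨f, hf, fun i j hi hj => hg i j (by omega) (by omega)⟩
  obtain ⟨f₀, hf₀⟩ := hQ
  by_cases hN : N % 2 = 0
  -- For even `N` only even lengths can be doubled; the start is `L = 2`, where sites `0` and `1`
  -- are unrelated.
  · have main : ∀ m, 2 * m + 2 ≤ N → ∃ f, Q f ∧ ReflInvariantUpTo N (2 * m + 2) f := by
      intro m
      induction m with
      | zero =>
        refine fun _ => ⟨f₀, hf₀, fun i j hi hj hij => ?_⟩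
        unfold ReflRel at hij
        congr 1
        omega
      | succ m ih => exact fun h => mono (by omega) (hdouble (by omega) (by omega) (ih (by omega)))
    rcases Nat.eq_zero_or_pos N with h0 | h0
    · exact ⟨f₀, hf₀, fun i j hi => by omega⟩
    · exact mono (by omega) (main (N / 2 - 1) (by omega))
  · have main : ∀ m, m + 1 ≤ N → ∃ f, Q f ∧ ReflInvariantUpTo N (m + 1) f := by
      intro m
      induction m with
      | zero =>
        refine fun _ => ⟨f₀, hf₀, fun i j hi hj _ => ?_⟩
        congr 1
        omega
      | succ m ih => exact fun h => mono (by omega) (hdouble (by omega) (by omega) (ih (by omega)))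
    exact mono (by omega) (main (N - 1) (by omega))

/-- A property of configurations that is stable under rotations by two sites and under reflecting
the left half-chain, and that holds for some configuration, holds for a palindrome which remains a
palindrome after rotation by two sites. -/
theorem exists_palindrome
    (hcongr : ∀ f g, (∀ i < 2 * N, f i = g i) → Q f → Q g)
    (hrot : ∀ f, Q f → Q fun i => f ((i + 2) % (2 * N)))
    (hfold : ∀ f, Q f → Q fun i => if i < N then f i else f (2 * N - 1 - i))
    (hQ : ∃ f, Q f) :
    ∃ f, Q f ∧ (∀ i < 2 * N, f (2 * N - 1 - i) = f i) ∧
      ∀ i < 2 * N, f ((2 * N - 1 - i + 2) % (2 * N)) = f ((i + 2) % (2 * N)) := by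
  obtain ⟨f, hf, hgood⟩ := exists_reflInvariantUpTo hcongr hrot hfold hQ
  -- One last fold extends the invariant half to the whole chain.
  refine ⟨_, hfold f hf, fun i hi => ?_, fun i hi => ?_⟩
  · split_ifs <;> first | omega | (congr 1 <;> omega)
  · rw [mod_eq_ite (x := i + 2) (by omega), mod_eq_ite (x := 2 * N - 1 - i + 2) (by omega)]
    have key : ∀ a b, a < 2 * N → b < 2 * N → ReflRel N a b →
        (if a < N then f a else f (2 * N - 1 - a)) = if b < N then f b else f (2 * N - 1 - b) := by
      intro a b ha hb hab
      unfold ReflRel at hab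
      split_ifs <;> exact hgood _ _ (by omega) (by omega) (by unfold ReflRel; omega)
    refine key _ _ (by split_ifs <;> omega) (by split_ifs <;> omega) ?_
    unfold ReflRel
    split_ifs <;> omega

end Chessboard

/-! ### Vectors of the chain as matrices -/

/-- The configuration with labels `s` on the left half-chain and, in reflected order, `t` on the
right half-chain. -/
def glue {d N : ℕ} (s t : Fin N → Fin d) : Fin (2 * N) → Fin d :=
  fun i => if h : (i : ℕ) < N then s ⟨i, h⟩ else t ⟨2 * N - 1 - i, by omega⟩

theorem leftHalf_glue {d N : ℕ} (s t : Fin N → Fin d) : leftHalf (glue s t) = s := by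
  funext i
  simp [leftHalf, glue]

theorem replaceLeft_glue {d N : ℕ} (r s t : Fin N → Fin d) :
    replaceLeft r (glue s t) = glue r t := by
  funext i
  by_cases h : (i : ℕ) < N <;> simp [replaceLeft, glue, h]

theorem glue_rev {d N : ℕ} (s t : Fin N → Fin d) : (fun i => glue s t i.rev) = glue t s := by
  funext i
  have hi := i.isLt
  have hr : ((i.rev : Fin (2 * N)) : ℕ) = 2 * N - 1 - i := by rw [Fin.val_rev]; omega
  by_cases h : (i : ℕ) < N
  · have h' : ¬ ((i.rev : Fin (2 * N)) : ℕ) < N := by omega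
    simp only [glue, h, h', dif_pos, dif_neg, not_false_eq_true]
    congr 2
    omega
  · have h' : ((i.rev : Fin (2 * N)) : ℕ) < N := by omega
    simp only [glue, h, h', dif_pos, dif_neg, not_false_eq_true]
    congr 2

/-- A configuration is the pair of its restrictions to the half-chains, both read outwards. -/
def glueEquiv (d N : ℕ) :
    (Fin N → Fin d) × (Fin N → Fin d) ≃ (Fin (2 * N) → Fin d) where
  toFun p := glue p.1 p.2
  invFun σ := (leftHalf σ, leftHalf fun i => σ i.rev)
  left_inv p := by simp [glue_rev, leftHalf_glue]
  right_inv σ := by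
    funext i
    have hi := i.isLt
    by_cases h : (i : ℕ) < N
    · simp [glue, leftHalf, h]
    · simp only [glue, leftHalf, h, dif_neg, not_false_eq_true]
      congr 1
      ext
      rw [Fin.val_rev]
      simp only
      omega

theorem glue_leftHalf {d N : ℕ} (σ : Fin (2 * N) → Fin d) :
    glue (leftHalf σ) (leftHalf fun i => σ i.rev) = σ := (glueEquiv d N).right_inv σ

theorem glue_self_of_palindrome {d N : ℕ} {σ : Fin (2 * N) → Fin d}
    (h : (fun i => σ i.rev) = σ) : glue (leftHalf σ) (leftHalf σ) = σ := by
  conv_rhs => rw [← glue_leftHalf σ, h]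

/-- The matrix of coefficients of a vector of the chain. -/
def coeffMatrix {d N : ℕ} (ψ : Hilb d N) : Matrix (Fin N → Fin d) (Fin N → Fin d) ℂ :=
  Matrix.of fun s t => ψ (glue s t)

theorem coeffMatrix_eq_zero {d N : ℕ} {ψ : Hilb d N} (h : coeffMatrix ψ = 0) : ψ = 0 := by
  ext σ
  rw [← glue_leftHalf σ]
  exact congrFun (congrFun h _) _

theorem coeffMatrix_leftOp {d N : ℕ} (y : Module.End ℂ (HalfHilb d N)) (ψ : Hilb d N)
    (s t : Fin N → Fin d) :
    leftOp d N y ψ (glue s t) = y (WithLp.toLp 2 fun r => ψ (glue r t)) s := by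
  change extendLeft y ψ (glue s t) = _
  simp only [extendLeft_apply, leftHalf_glue, replaceLeft_glue]

theorem crt_glue {d N : ℕ} (ψ : Hilb d N) (s t : Fin N → Fin d) :
    crt d N ψ (glue s t) = star (ψ (glue t s)) := by
  rw [crt_apply, glue_rev]
  rfl

/-- Reflection positivity tested on the rank one operators `|u⟩⟨v|`. -/
theorem IsReflectionPositive.quadratic_forms {d N : ℕ} {Ω : Hilb d N}
    (hRP : IsReflectionPositive (pureState Ω)) (u v : (Fin N → Fin d) → ℂ) :
    0 ≤ star (star u ⬝ᵥ coeffMatrix Ω *ᵥ u) * (star v ⬝ᵥ coeffMatrix Ω *ᵥ v) := by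
  let y : Module.End ℂ (HalfHilb d N) :=
    (innerSL ℂ (WithLp.toLp 2 v : HalfHilb d N)).toLinearMap.smulRight (WithLp.toLp 2 u)
  have hy : ∀ (w s), y (WithLp.toLp 2 w) s = (∑ r, w r * star (v r)) * u s := fun w s => by
    simp [y, PiLp.inner_apply]
  have h := hRP (leftOp d N y) ⟨y, rfl⟩
  rw [trace_pureState_mul] at h
  have hval : ∀ s t, (leftOp d N y * crtConj (leftOp d N y)) Ω (glue s t) =
      u s * star (u t) * (star v ⬝ᵥ coeffMatrix Ω *ᵥ v) := by
    intro s t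
    change leftOp d N y (crt d N (leftOp d N y (crt d N Ω))) (glue s t) = _
    simp only [coeffMatrix_leftOp, crt_glue, hy]
    simp only [dotProduct, mulVec, coeffMatrix, of_apply, Finset.mul_sum, Finset.sum_mul,
      star_mul', star_sum, star_star, Pi.star_apply]
    refine Finset.sum_congr rfl fun _ _ => Finset.sum_congr rfl fun _ _ => ?_
    ring
  convert h using 1
  rw [PiLp.inner_apply, ← (glueEquiv d N).sum_comp, Fintype.sum_prod_type]
  change _ = ∑ s, ∑ t, inner ℂ (Ω (glue s t)) (((leftOp d N y * crtConj (leftOp d N y)) Ω) (glue s t))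
  simp only [hval]
  generalize (star v ⬝ᵥ coeffMatrix Ω *ᵥ v) = b
  simp only [dotProduct, mulVec, coeffMatrix, of_apply, Finset.mul_sum, Finset.sum_mul,
      star_mul', star_sum, star_star, Pi.star_apply, RCLike.inner_apply]
  refine Finset.sum_congr rfl fun _ _ => Finset.sum_congr rfl fun _ _ => ?_
  simp only [starRingEnd_apply]
  ring

/-- Polarization over `ℂ`. -/
theorem eq_zero_of_forall_dotProduct_eq_zero {n : Type*} [Fintype n] [DecidableEq n]
    {A : Matrix n n ℂ} (h : ∀ u, star u ⬝ᵥ A *ᵥ u = 0) : A = 0 := by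
  apply toEuclideanLin.injective
  rw [map_zero, ← inner_map_self_eq_zero]
  intro x
  rw [inner_eq_zero_symm, EuclideanSpace.inner_eq_star_dotProduct, dotProduct_comm]
  exact h _

/-- Hermiticity is automatic: the form is real, so that of `Aᴴ - A` vanishes. -/
theorem posSemidef_of_forall_dotProduct_nonneg {n : Type*} [Fintype n] [DecidableEq n]
    {A : Matrix n n ℂ} (h : ∀ u, 0 ≤ star u ⬝ᵥ A *ᵥ u) : A.PosSemidef := by
  rw [posSemidef_iff_dotProduct_mulVec]
  refine ⟨sub_eq_zero.mp (eq_zero_of_forall_dotProduct_eq_zero fun u => ?_), h⟩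
  have hstar : star u ⬝ᵥ Aᴴ *ᵥ u = star (star u ⬝ᵥ A *ᵥ u) := by
    rw [dotProduct_mulVec, ← star_mulVec, star_dotProduct]
  rw [sub_mulVec, dotProduct_sub, hstar, (IsSelfAdjoint.of_nonneg (h u)).star_eq, sub_self]

/-- The matrix of a reflection positive vector is positive up to a phase. -/
theorem IsReflectionPositive.exists_posSemidef {d N : ℕ} {Ω : Hilb d N}
    (hRP : IsReflectionPositive (pureState Ω)) (hΩ : Ω ≠ 0) :
    ∃ c : ℂ, c ≠ 0 ∧ (c • coeffMatrix Ω).PosSemidef := by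
  have hne : ∃ u, star u ⬝ᵥ coeffMatrix Ω *ᵥ u ≠ 0 := by
    by_contra! h
    exact hΩ (coeffMatrix_eq_zero (eq_zero_of_forall_dotProduct_eq_zero h))
  obtain ⟨u, hu⟩ := hne
  refine ⟨star (star u ⬝ᵥ coeffMatrix Ω *ᵥ u), star_ne_zero.mpr hu,
    posSemidef_of_forall_dotProduct_nonneg fun v => ?_⟩
  rw [smul_mulVec, dotProduct_smul, smul_eq_mul]
  exact hRP.quadratic_forms u v

/-- The 2×2 minor on rows and columns `s`, `t` is nonnegative. -/
theorem norm_sq_le_of_posSemidef {n : Type*} [Fintype n] [DecidableEq n]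
    {A : Matrix n n ℂ} (h : A.PosSemidef) (s t : n) : ‖A s t‖ ^ 2 ≤ ‖A s s‖ * ‖A t t‖ := by
  have hdet := (h.submatrix ![s, t]).det_nonneg
  have hts : A t s = star (A s t) := (h.isHermitian.apply t s).symm
  simp only [det_fin_two, submatrix_apply, cons_val_zero, cons_val_one, hts] at hdet
  have hs := h.diag_nonneg (i := s)
  have ht := h.diag_nonneg (i := t)
  rw [RCLike.star_def, Complex.mul_conj', Complex.eq_coe_norm_of_nonneg hs,
    Complex.eq_coe_norm_of_nonneg ht] at hdet
  have hle := sub_nonneg.mp hdet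
  exact_mod_cast hle

/-- An invariant vector state is represented by an eigenvector. -/
theorem IsRotationInvariant.exists_eigenvalue {d N : ℕ} {Ω : Hilb d N} (hΩ : ‖Ω‖ = 1)
    (hrot : IsRotationInvariant (pureState Ω)) :
    ∃ z : ℂ, ‖z‖ = 1 ∧ shiftTwo d N Ω = z • Ω := by
  -- Testing on `ρ` itself gives `⟪Ω, U⁻¹Ω⟫ ⟪Ω, UΩ⟫ = 1`; both factors have norm at most `1`, so
  -- Cauchy–Schwarz is an equality.
  have h := hrot (pureState Ω)
  rw [trace_pureState_mul, trace_pureState_mul] at h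
  have hΩ0 : Ω ≠ 0 := by
    rintro rfl
    simp at hΩ
  simp only [LinearEquiv.conj_apply_apply, pureState_apply, map_smul, inner_smul_right,
    inner_self_eq_norm_sq_to_K, hΩ] at h
  have h1 : ‖⟪Ω, (shiftTwo d N).symm Ω⟫_ℂ‖ ≤ 1 := by
    simpa [hΩ] using norm_inner_le_norm (𝕜 := ℂ) Ω ((shiftTwo d N).symm Ω)
  have h2 : ‖⟪Ω, shiftTwo d N Ω⟫_ℂ‖ ≤ 1 := by
    simpa [hΩ] using norm_inner_le_norm (𝕜 := ℂ) Ω (shiftTwo d N Ω)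
  have h3 : ‖⟪Ω, (shiftTwo d N).symm Ω⟫_ℂ‖ * ‖⟪Ω, shiftTwo d N Ω⟫_ℂ‖ = 1 := by
    rw [← norm_mul]
    have := congrArg norm h
    simpa using this
  have h4 : ‖⟪Ω, shiftTwo d N Ω⟫_ℂ‖ = ‖Ω‖ * ‖shiftTwo d N Ω‖ := by
    rw [LinearIsometryEquiv.norm_map, hΩ]
    nlinarith [norm_nonneg ⟪Ω, shiftTwo d N Ω⟫_ℂ]
  have hU0 : shiftTwo d N Ω ≠ 0 := by simpa using hΩ0
  obtain ⟨z, hz, hzU⟩ := (norm_inner_eq_norm_iff hΩ0 hU0).mp h4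
  refine ⟨z, ?_, hzU⟩
  simpa [norm_smul, hΩ] using (congrArg norm hzU).symm

theorem shiftTwo_glue {d N : ℕ} (ψ : Hilb d N) (f : ℕ → Fin d) :
    shiftTwo d N ψ (fun i => f i) = ψ fun i => f ((i + 2) % (2 * N)) := by
  simp only [shiftTwo_apply, shiftSites_val]

end SpinChain

theorem mainTheorem9 (d N : ℕ) (Ω : SpinChain.Hilb d N) (hΩ : ‖Ω‖ = 1)
    (hrot : SpinChain.IsRotationInvariant (SpinChain.pureState Ω))
    (hRP : SpinChain.IsReflectionPositive (SpinChain.pureState Ω)) :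
    SpinChain.shiftTwo d N Ω = Ω := by
  open SpinChain in
  have hΩ0 : Ω ≠ 0 := by
    rintro rfl
    simp at hΩ
  obtain ⟨z, hz, hzU⟩ := hrot.exists_eigenvalue hΩ
  obtain ⟨c, hc, hpos⟩ := hRP.exists_posSemidef hΩ0
  have hcs : ∀ s t, ‖Ω (glue s t)‖ ^ 2 ≤ ‖Ω (glue s s)‖ * ‖Ω (glue t t)‖ := by
    intro s t
    have h := norm_sq_le_of_posSemidef hpos s t
    simp only [Matrix.smul_apply, coeffMatrix, Matrix.of_apply, smul_eq_mul, norm_mul] at h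
    have hc' : 0 < ‖c‖ ^ 2 := by positivity
    refine le_of_mul_le_mul_left ?_ hc'
    linarith
  obtain ⟨σ₀, hσ₀⟩ : ∃ σ, Ω σ ≠ 0 := by
    by_contra! h
    exact hΩ0 (PiLp.ext h)
  have : Nonempty (Fin (2 * N) → Fin d) := ⟨σ₀⟩
  obtain ⟨σ₁, hσ₁⟩ := Finite.exists_max fun σ => ‖Ω σ‖
  rcases Nat.eq_zero_or_pos N with rfl | hN
  · ext σ
    rw [shiftTwo_apply]
    exact congrArg Ω (funext fun i => i.elim0)
  -- `Q f` says that `f` maximizes `|Ω|`; only the first `2 * N` values matter.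
  let Q : (ℕ → Fin d) → Prop := fun f => ∀ σ, ‖Ω σ‖ ≤ ‖Ω fun i => f i‖
  have hshift : ∀ f : ℕ → Fin d, (Ω fun i => f ((i + 2) % (2 * N))) = z * Ω fun i => f i := by
    intro f
    rw [← shiftTwo_glue, hzU]
    rfl
  obtain ⟨f, hf, hpal, hpal'⟩ := exists_palindrome (N := N) (Q := Q)
    (fun f g h hf => by
      have : (fun i : Fin (2 * N) => g i) = fun i : Fin (2 * N) => f i :=
        funext fun i => (h i i.isLt).symm
      simpa only [Q, this] using hf)
    (fun f hf σ => by
      change _ ≤ ‖Ω fun i : Fin (2 * N) => f ((i + 2) % (2 * N))‖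
      rw [hshift, norm_mul, hz, one_mul]
      exact hf σ)
    (fun f hf σ => by
      refine (hf σ).trans ?_
      have h := hcs (fun i => f i) (fun i => f (2 * N - 1 - i))
      have e1 : glue (fun i : Fin N => f i) (fun i : Fin N => f (2 * N - 1 - i)) =
          fun i : Fin (2 * N) => f i := by
        funext i
        simp only [glue]
        split_ifs
        · rfl
        · congr 1
          omega
      have e2 : glue (fun i : Fin N => f i) (fun i : Fin N => f i) =
          fun i : Fin (2 * N) => if (i : ℕ) < N then f i else f (2 * N - 1 - i) := by
        funext i
        simp only [glue]
        split_ifs <;> rfl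
      rw [e1, e2] at h
      -- The other folded configuration is at most the maximum, so one factor of the maximum
      -- cancels.
      have hm := hf (glue (fun i : Fin N => f (2 * N - 1 - i)) fun i : Fin N => f (2 * N - 1 - i))
      have hpos : 0 < ‖Ω fun i : Fin (2 * N) => f i‖ :=
        (norm_pos_iff.mpr hσ₀).trans_le (hf σ₀)
      refine le_of_mul_le_mul_right ?_ hpos
      rw [← sq]
      exact h.trans (mul_le_mul_of_nonneg_left hm (norm_nonneg _)))
    ⟨fun i => if h : i < 2 * N then σ₁ ⟨i, h⟩ else σ₁ ⟨0, by omega⟩, fun σ => by simpa using hσ₁ σ⟩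
  have hnonneg : ∀ σ : Fin (2 * N) → Fin d, (fun i => σ i.rev) = σ → 0 ≤ c * Ω σ := by
    intro σ hσ
    have h := hpos.diag_nonneg (i := leftHalf σ)
    rwa [Matrix.smul_apply, coeffMatrix, Matrix.of_apply, glue_self_of_palindrome hσ] at h
  have hrev : ∀ i : Fin (2 * N), ((i.rev : Fin (2 * N)) : ℕ) = 2 * N - 1 - i := by
    intro i
    rw [Fin.val_rev]
    omega
  have h1 : 0 ≤ c * Ω fun i => f i :=
    hnonneg _ (funext fun i => by rw [hrev]; exact hpal i i.isLt)
  have h2 : 0 ≤ c * (z * Ω fun i => f i) := by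
    rw [← hshift]
    exact hnonneg _ (funext fun i => by rw [hrev]; exact hpal' i i.isLt)
  have hne : (c * Ω fun i => f i) ≠ 0 :=
    mul_ne_zero hc (norm_pos_iff.mp ((norm_pos_iff.mpr hσ₀).trans_le (hf σ₀)))
  -- Two nonnegative numbers of equal modulus coincide.
  have hz1 : z = 1 := by
    have e : c * (z * Ω fun i => f i) = z * (c * Ω fun i => f i) := by ring
    have e1 := Complex.eq_coe_norm_of_nonneg h1
    have e2 := Complex.eq_coe_norm_of_nonneg h2
    rw [e, norm_mul, hz, one_mul, ← e1] at e2
    exact mul_right_cancel₀ hne (e2.trans (one_mul _).symm)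
  rw [hzU, hz1, one_smul]
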